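/- Let $k>0$, and let $(\Omega,\mathcal F,\mu)$ be a probability space. For a probability measure $P_0$ on a measurable space $(\mathcal X,\mathcal A)$, a Dirichlet process $P$ with parameter $kP_0$ is a random probability measure on $\mathcal X$, that is, a measurable map from $\Omega$ to the space $\mathcal M$ of probability measures on $(\mathcal X,\mathcal A)$ with the $\sigma$-field generated by the maps $Q\mapsto Q(A)$, $A\in\mathcal A$, such that for every finite measurable partition $A_1,\dots,A_n$ of $\mathcal X$ the vector $(P(A_1),\dots,P(A_n))$ has the Dirichlet distribution with parameters $kP_0(A_1),\dots,kP_0(A_n)$ (a zero parameter giving a coordinate that is almost surely $0$). (i) Suppose that $\{x\}\in\mathcal A$ for every $x\in\mathcal X$ and that $(Q,x)\mapsto Q(\{x\})$ is measurable on $\mathcal M\times\mathcal X$; this holds, for example, for the Borel $\sigma$-field of a separable metric space. Let $P$ be a Dirichlet process with parameter $kP_0$ on $\mathcal X$. Then for each $A\in\mathcal A$ with $P_0(A)>0$, with probability one there is an $x\in A$ with $P(\{x\})>0$. (ii) Let $P$ be a Dirichlet process with parameter $kP_0$ on the real line with its Borel sets, and let $F(t)=P((-\infty,t])$ be its random distribution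 function. Then, with probability one, simultaneously for all intervals $I\subseteq\mathbb R$ such that $P_0(I\setminus S)>0$ for every finite set $S$ (that is, $P_0$ charges $I$ and its restriction to $I$ is not concentrated on finitely many points; if $P_0$ has no atoms, this just says $P_0(I)>0$), the set $\{x\in I : F(x-)<F(x)\}$ of jumps of $F$ in $I$ is infinite. -/

import Mathlib

open MeasureTheory ProbabilityTheory
open scoped NNReal ENNReal

noncomputable section

/-- The gamma law with shape `a` and scale one, where shape zero is read as the point mass at
zero. -/
def gammaOrZero (a : ℝ) : Measure ℝ :=
  if a = 0 then Measure.dirac 0 else gammaMeasure a 1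

/-- The Dirichlet distribution with parameters `a i ≥ 0`, not all zero: the law of
`(Z i / ∑ j, Z j)` for independent gamma variables `Z i` with shapes `a i` and scale one
(`Z i = 0` when `a i = 0`). -/
def dirichletMeasure {n : ℕ} (a : Fin n → ℝ) : Measure (Fin n → ℝ) :=
  (Measure.pi fun i => gammaOrZero (a i)).map fun z i => z i / ∑ j, z j

/-- The random probability measure `P`, defined on `(Ω, μ)`, is a Dirichlet process with
parameter the finite measure `α`: for every finite measurable partition `A` of the space, the
vector `(P (A i))` has the Dirichlet distribution with parameters `α (A i)`. The space of
probability measures carries the sigma-field generated by the evaluations at measurable sets. -/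
structure IsDirichletProcess {Ω X : Type*} [MeasurableSpace Ω] [MeasurableSpace X]
    (μ : Measure Ω) (α : Measure X) (P : Ω → ProbabilityMeasure X) : Prop where
  measurable : Measurable P
  map_partition : ∀ (n : ℕ) (A : Fin n → Set X), (∀ i, MeasurableSet (A i)) →
    (Pairwise fun i j => Disjoint (A i) (A j)) → (⋃ i, A i) = Set.univ →
    μ.map (fun ω i => (P ω : Measure X).real (A i)) = dirichletMeasure fun i => α.real (A i)

/-- The points at which a (monotone) function `F` on the line jumps: `F(x-) < F(x)`. -/
def jumpSet (F : ℝ → ℝ) : Set ℝ :=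
  {x | Function.leftLim F x < F x}

end

/-! Given P, draw a point x from P. The theorem rests on one identity
(`IsDirichletProcess.compProd_drawKernel`): the pair (P, x) has the law of (V δ_x + (1 - V) P', x),
where x has law P₀, V is beta(1, k), P' is a copy of P, and the three are independent. In the second
pair the first measure gives x mass at least V > 0. Hence almost surely P-almost every point is an
atom of P, and every set that P charges contains an atom. If P₀(A) > 0 then P(A) > 0 almost surely,
which gives (i).

The identity is first proved for Dirichlet vectors (`lintegral_apply_mul_dirichletMeasure`) and then
lifted by a π-system of cylinders. For vectors it follows from gamma variables: size-biasing a gamma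
variable adds an independent exponential one, and the normalised vector is independent of the sum
(`map_normalize_sum_pi_gammaOrZero`). Both facts are obtained from Laplace transforms or densities.

For (ii), apply (i) to the countably many rational intervals. If I held finitely many jumps,
removing them and the endpoints of I would leave an open set charged by P₀, hence a charged rational
interval with no atom. -/

/-! ### Uniqueness of Laplace transforms. -/

/-- Two finite measures on the line whose Laplace transforms are finite and agree on `(-∞, 1)`
are equal. -/
theorem MeasureTheory.Measure.ext_of_lintegral_exp {μ ν : Measure ℝ} [IsFiniteMeasure μ]
    [IsFiniteMeasure ν]
    (hfin : ∀ t < (1 : ℝ), ∫⁻ x, ENNReal.ofReal (Real.exp (t * x)) ∂μ ≠ ∞)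
    (h : ∀ t < (1 : ℝ), ∫⁻ x, ENNReal.ofReal (Real.exp (t * x)) ∂μ =
      ∫⁻ x, ENNReal.ofReal (Real.exp (t * x)) ∂ν) : μ = ν := by
  have key : ∀ ρ : Measure ℝ,
      (∀ t < (1 : ℝ), ∫⁻ x, ENNReal.ofReal (Real.exp (t * x)) ∂ρ ≠ ∞) →
      AnalyticOnNhd ℂ (complexMGF id ρ) {z | z.re < 1} := by
    intro ρ hρ
    refine analyticOnNhd_complexMGF.mono fun z hz => ?_
    have hsub : Set.Iio (1 : ℝ) ⊆ integrableExpSet id ρ := by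
      intro t ht
      refine ⟨by fun_prop, ?_⟩
      rw [hasFiniteIntegral_iff_ofReal (ae_of_all _ fun x => (Real.exp_pos _).le)]
      exact (hρ t ht).lt_top
    exact interior_maximal hsub isOpen_Iio hz
  have hconv : Convex ℝ {z : ℂ | z.re < 1} := convex_halfSpace_re_lt 1
  have hEq : Set.EqOn (complexMGF id μ) (complexMGF id ν) {z | z.re < 1} := by
    refine (key μ hfin).eqOn_of_preconnected_of_frequently_eq
      (key ν fun t ht => h t ht ▸ hfin t ht) hconv.isPreconnected (z₀ := ((0 : ℝ) : ℂ))
      (by simp) ?_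
    -- Agreement at reals near 0 suffices: they accumulate at 0 inside the connected half-plane Re z
    -- < 1. This half-plane contains the imaginary axis, where the transform is the characteristic
    -- function.
    have h_real : ∃ᶠ x : ℝ in nhdsWithin 0 {0}ᶜ, complexMGF id μ x = complexMGF id ν x := by
      refine Filter.Eventually.frequently ?_
      filter_upwards [mem_nhdsWithin_of_mem_nhds (Iio_mem_nhds (zero_lt_one (α := ℝ)))] with t ht
      rw [complexMGF_ofReal, complexMGF_ofReal]
      simp only [mgf, id]
      rw [integral_eq_lintegral_of_nonneg_ae (ae_of_all _ fun x => (Real.exp_pos _).le)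
        (by fun_prop), integral_eq_lintegral_of_nonneg_ae
        (ae_of_all _ fun x => (Real.exp_pos _).le) (by fun_prop), h t ht]
    refine Filter.Tendsto.frequently (f := fun x : ℝ => (x : ℂ)) ?_ h_real
    refine tendsto_nhdsWithin_iff.2 ⟨?_, ?_⟩
    · exact (Complex.continuous_ofReal.tendsto 0).mono_left nhdsWithin_le_nhds
    · filter_upwards [self_mem_nhdsWithin] with x hx
      simpa using hx
  refine Measure.ext_of_charFun (funext fun t => ?_)
  rw [← complexMGF_id_mul_I, ← complexMGF_id_mul_I]
  exact hEq (by simp)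

/-! ### Tilting, size-biasing and addition of gamma laws. -/

theorem isProbabilityMeasure_gammaOrZero {a : ℝ} (ha : 0 ≤ a) :
    IsProbabilityMeasure (gammaOrZero a) := by
  unfold gammaOrZero
  split_ifs with h
  · infer_instance
  · exact isProbabilityMeasure_gammaMeasure (lt_of_le_of_ne ha (Ne.symm h)) one_pos

theorem measurable_gammaPDF (a r : ℝ) : Measurable (gammaPDF a r) :=
  (measurable_gammaPDFReal a r).ennreal_ofReal

theorem ae_pos_gammaOrZero {a : ℝ} (ha : 0 < a) : ∀ᵐ z ∂gammaOrZero a, 0 < z := by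
  rw [gammaOrZero, if_neg ha.ne', gammaMeasure,
    ae_withDensity_iff (measurable_gammaPDF a 1)]
  filter_upwards [Measure.ae_ne volume (0 : ℝ)] with z hz h
  by_contra hneg
  exact h (gammaPDF_of_neg (lt_of_le_of_ne (not_lt.1 hneg) hz))

theorem ae_nonneg_gammaOrZero {a : ℝ} (ha : 0 ≤ a) : ∀ᵐ z ∂gammaOrZero a, 0 ≤ z := by
  rcases ha.eq_or_lt with rfl | h
  · simp [gammaOrZero, ae_dirac_eq]
  · filter_upwards [ae_pos_gammaOrZero h] with z hz using hz.le

theorem lintegral_gammaOrZero {a : ℝ} (ha : 0 < a) {f : ℝ → ℝ≥0∞} (hf : Measurable f) :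
    ∫⁻ z, f z ∂gammaOrZero a = ∫⁻ z, gammaPDF a 1 z * f z := by
  rw [gammaOrZero, if_neg ha.ne', gammaMeasure, lintegral_withDensity_eq_lintegral_mul _
    (measurable_gammaPDF a 1) hf]
  rfl

/-- Exponential tilting of a gamma law is a rescaling. -/
theorem lintegral_exp_mul_gammaOrZero {a : ℝ} (ha : 0 ≤ a) {t : ℝ} (ht : t < 1)
    {f : ℝ → ℝ≥0∞} (hf : Measurable f) :
    ∫⁻ z, ENNReal.ofReal (Real.exp (t * z)) * f z ∂gammaOrZero a =
      ENNReal.ofReal ((1 - t) ^ (-a)) * ∫⁻ z, f (z / (1 - t)) ∂gammaOrZero a := by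
  have hc : 0 < 1 - t := by linarith
  rcases ha.eq_or_lt with rfl | ha
  · simp [gammaOrZero]
  rw [lintegral_gammaOrZero ha (by fun_prop), lintegral_gammaOrZero ha (by fun_prop)]
  have hpdf : Measurable (gammaPDF a 1) := measurable_gammaPDF a 1
  have hmul : ∀ g : ℝ → ℝ≥0∞, Measurable g →
      ∫⁻ z, g z = ENNReal.ofReal (1 - t) * ∫⁻ z, g ((1 - t) * z) := by
    intro g hg
    conv_lhs => rw [← Real.smul_map_volume_mul_left hc.ne']
    rw [lintegral_smul_measure, lintegral_map hg (by fun_prop), abs_of_pos hc, smul_eq_mul]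
  rw [hmul (fun z => gammaPDF a 1 z * f (z / (1 - t))) (by fun_prop), ← mul_assoc,
    ← lintegral_const_mul _ (by fun_prop)]
  refine lintegral_congr fun z => ?_
  rw [mul_div_cancel_left₀ _ hc.ne', ← mul_assoc, ← mul_assoc]
  congr 1
  rcases lt_or_ge z 0 with hz | hz
  · rw [gammaPDF_of_neg hz, gammaPDF_of_neg (mul_neg_of_pos_of_neg hc hz)]
    simp
  · rw [gammaPDF_of_nonneg hz, gammaPDF_of_nonneg (by positivity),
      ← ENNReal.ofReal_mul (by positivity), ← ENNReal.ofReal_mul (by positivity),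
      ← ENNReal.ofReal_mul (by positivity)]
    congr 1
    rw [Real.mul_rpow hc.le hz, Real.rpow_sub_one hc.ne', Real.rpow_neg hc.le]
    have h1 : Real.exp (-(1 * z)) * Real.exp (t * z) = Real.exp (-(1 * ((1 - t) * z))) := by
      rw [← Real.exp_add]; congr 1; ring
    rw [mul_assoc, h1]
    have := (Real.rpow_pos_of_pos hc a).ne'
    field_simp

theorem lintegral_exp_gammaOrZero {a : ℝ} (ha : 0 ≤ a) {t : ℝ} (ht : t < 1) :
    ∫⁻ z, ENNReal.ofReal (Real.exp (t * z)) ∂gammaOrZero a = ENNReal.ofReal ((1 - t) ^ (-a)) := by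
  have := isProbabilityMeasure_gammaOrZero ha
  simpa using lintegral_exp_mul_gammaOrZero ha ht (f := fun _ => 1) measurable_const

/-- Size-biasing of a gamma law raises its shape by one. -/
theorem lintegral_id_mul_gammaOrZero {a : ℝ} (ha : 0 ≤ a) {f : ℝ → ℝ≥0∞} (hf : Measurable f) :
    ∫⁻ z, ENNReal.ofReal z * f z ∂gammaOrZero a =
      ENNReal.ofReal a * ∫⁻ z, f z ∂gammaOrZero (a + 1) := by
  rcases ha.eq_or_lt with rfl | ha
  · simp [gammaOrZero]
  have hpdf : Measurable (gammaPDF (a + 1) 1) := measurable_gammaPDF _ _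
  rw [lintegral_gammaOrZero ha (by fun_prop), lintegral_gammaOrZero (by linarith) hf,
    ← lintegral_const_mul _ (by fun_prop)]
  refine lintegral_congr fun z => ?_
  rw [← mul_assoc, ← mul_assoc]
  congr 1
  rcases lt_or_ge z 0 with hz | hz
  · simp [gammaPDF_of_neg hz]
  -- At z = 0 both sides vanish, the right one because 0 ^ a = 0 for a > 0; dividing by z is
  -- legitimate afterwards.
  rcases hz.eq_or_lt with rfl | hz
  · simp [gammaPDF_of_nonneg le_rfl, Real.zero_rpow ha.ne']
  have hG := Real.Gamma_pos_of_pos ha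
  have hG1 := Real.Gamma_pos_of_pos (show 0 < a + 1 by linarith)
  rw [gammaPDF_of_nonneg hz.le, gammaPDF_of_nonneg hz.le,
    ← ENNReal.ofReal_mul (by positivity), ← ENNReal.ofReal_mul (by positivity)]
  congr 1
  rw [Real.Gamma_add_one ha.ne', Real.rpow_sub_one hz.ne', add_sub_cancel_right]
  simp only [Real.one_rpow]
  field_simp

/-- A gamma variable of shape `a + 1` is the sum of independent ones of shapes `a` and `1`. -/
theorem gammaOrZero_add_one {a : ℝ} (ha : 0 ≤ a) :
    ((gammaOrZero a).prod (gammaOrZero 1)).map (fun p => p.1 + p.2) = gammaOrZero (a + 1) := by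
  have := isProbabilityMeasure_gammaOrZero ha
  have := isProbabilityMeasure_gammaOrZero zero_le_one
  have := isProbabilityMeasure_gammaOrZero (show 0 ≤ a + 1 by linarith)
  refine (Measure.ext_of_lintegral_exp (fun t ht => ?_) fun t ht => ?_).symm
  · rw [lintegral_exp_gammaOrZero (by linarith) ht]
    exact ENNReal.ofReal_ne_top
  · have hc : 0 < 1 - t := by linarith
    rw [lintegral_map (by fun_prop) (by fun_prop), lintegral_prod _ (by fun_prop)]
    simp_rw [mul_add, Real.exp_add, ENNReal.ofReal_mul (Real.exp_pos _).le]
    simp_rw [lintegral_const_mul' _ _ ENNReal.ofReal_ne_top]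
    rw [lintegral_mul_const _ (by fun_prop), lintegral_exp_gammaOrZero ha ht,
      lintegral_exp_gammaOrZero zero_le_one ht, lintegral_exp_gammaOrZero (by linarith) ht,
      ← ENNReal.ofReal_mul (by positivity), ← Real.rpow_add hc]
    congr 2
    ring

/-! ### Independent gamma variables: their sum and their normalised vector. -/

/-- On a box, the product density times the indicator is a product of functions of separate
coordinates, so its integral factors by independence. -/
theorem MeasureTheory.Measure.pi_withDensity {ι : Type*} [Fintype ι] {E : ι → Type*}
    [∀ i, MeasurableSpace (E i)] (μ : ∀ i, Measure (E i)) [∀ i, IsProbabilityMeasure (μ i)]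
    (f : ∀ i, E i → ℝ≥0∞) (hf : ∀ i, Measurable (f i))
    [∀ i, SigmaFinite ((μ i).withDensity (f i))] :
    Measure.pi (fun i => (μ i).withDensity (f i)) =
      (Measure.pi μ).withDensity fun z => ∏ i, f i (z i) := by
  refine Measure.pi_eq fun s hs => ?_
  have hind : iIndepFun (fun i (z : ∀ i, E i) => (s i).indicator (f i) (z i)) (Measure.pi μ) :=
    iIndepFun_pi fun i => ((hf i).indicator (hs i)).aemeasurable
  have hm : ∀ i, Measurable fun z : ∀ i, E i => (s i).indicator (f i) (z i) := fun i =>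
    ((hf i).indicator (hs i)).comp (measurable_pi_apply i)
  rw [withDensity_apply _ (MeasurableSet.univ_pi hs),
    ← lintegral_indicator (MeasurableSet.univ_pi hs)]
  have : ∀ z : ∀ i, E i, (Set.univ.pi s).indicator (fun z => ∏ i, f i (z i)) z =
      ∏ i, (s i).indicator (f i) (z i) := by
    intro z
    by_cases hz : z ∈ Set.univ.pi s
    · rw [Set.indicator_of_mem hz]
      exact Finset.prod_congr rfl fun i _ => (Set.indicator_of_mem (hz i trivial) _).symm
    · rw [Set.indicator_of_notMem hz]
      obtain ⟨i, hi⟩ : ∃ i, z i ∉ s i := by simpa [Set.mem_pi] using hz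
      exact (Finset.prod_eq_zero (Finset.mem_univ i) (Set.indicator_of_notMem hi _)).symm
  simp_rw [this]
  rw [lintegral_prod_eq_prod_lintegral_of_indepFun _ _ hind hm]
  refine Finset.prod_congr rfl fun i _ => ?_
  rw [withDensity_apply _ (hs i), ← lintegral_indicator (hs i),
    ← lintegral_map ((hf i).indicator (hs i)) (measurable_pi_apply i),
    (measurePreserving_eval μ i).map_eq]

/-- The tilt, normalised to a probability density and stated for measures, so that
`Measure.pi_withDensity` can tilt all coordinates at once. -/
theorem map_div_gammaOrZero {a : ℝ} (ha : 0 ≤ a) {t : ℝ} (ht : t < 1) :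
    (gammaOrZero a).withDensity (fun z => ENNReal.ofReal ((1 - t) ^ a * Real.exp (t * z))) =
      (gammaOrZero a).map (fun z => z / (1 - t)) := by
  have hc : 0 < 1 - t := by linarith
  refine Measure.ext_of_lintegral _ fun f hf => ?_
  rw [lintegral_map hf (by fun_prop), lintegral_withDensity_eq_lintegral_mul _ (by fun_prop) hf]
  simp only [Pi.mul_apply, ENNReal.ofReal_mul (Real.rpow_nonneg hc.le a), mul_assoc]
  rw [lintegral_const_mul _ (by fun_prop), lintegral_exp_mul_gammaOrZero ha ht hf, ← mul_assoc,
    ← ENNReal.ofReal_mul (by positivity), ← Real.rpow_add hc]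
  simp

/-- Exponential tilting of independent gamma variables is a rescaling. -/
theorem lintegral_exp_sum_mul_pi_gammaOrZero {n : ℕ} {a : Fin n → ℝ} (ha : ∀ i, 0 ≤ a i) {t : ℝ}
    (ht : t < 1) {f : (Fin n → ℝ) → ℝ≥0∞} (hf : Measurable f) :
    ∫⁻ z, ENNReal.ofReal (Real.exp (t * ∑ i, z i)) * f z
        ∂Measure.pi (fun i => gammaOrZero (a i)) =
      ENNReal.ofReal ((1 - t) ^ (-∑ i, a i)) *
        ∫⁻ z, f (fun i => z i / (1 - t)) ∂Measure.pi (fun i => gammaOrZero (a i)) := by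
  have hc : 0 < 1 - t := by linarith
  have := fun i => isProbabilityMeasure_gammaOrZero (ha i)
  have hp : ∀ i, IsProbabilityMeasure ((gammaOrZero (a i)).map (fun z => z / (1 - t))) :=
    fun i => Measure.isProbabilityMeasure_map (by fun_prop)
  have hp' : ∀ i, IsProbabilityMeasure ((gammaOrZero (a i)).withDensity
      (fun z => ENNReal.ofReal ((1 - t) ^ (a i) * Real.exp (t * z)))) := by
    intro i
    rw [map_div_gammaOrZero (ha i) ht]
    exact hp i
  have hmap := Measure.pi_withDensity (fun i => gammaOrZero (a i))
    (fun i z => ENNReal.ofReal ((1 - t) ^ (a i) * Real.exp (t * z))) (fun i => by fun_prop)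
  simp_rw [map_div_gammaOrZero (ha _) ht] at hmap
  rw [← Measure.pi_map_pi (fun i => by fun_prop)] at hmap
  rw [← lintegral_map (f := f) (g := fun (z : Fin n → ℝ) i => z i / (1 - t)) hf (by fun_prop), hmap,
    lintegral_withDensity_eq_lintegral_mul _ (by fun_prop) hf, ← lintegral_const_mul _ (by fun_prop)]
  refine lintegral_congr fun z => ?_
  rw [Pi.mul_apply, ← mul_assoc, ← ENNReal.ofReal_prod_of_nonneg fun i _ => by positivity,
    ← ENNReal.ofReal_mul (by positivity)]
  congr 2
  rw [Finset.prod_mul_distrib, ← Real.rpow_sum_of_pos hc, ← Real.exp_sum, ← Finset.mul_sum,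
    ← mul_assoc, ← Real.rpow_add hc]
  simp

theorem isProbabilityMeasure_dirichletMeasure {n : ℕ} {a : Fin n → ℝ} (ha : ∀ i, 0 ≤ a i) :
    IsProbabilityMeasure (dirichletMeasure a) := by
  have := fun i => isProbabilityMeasure_gammaOrZero (ha i)
  exact Measure.isProbabilityMeasure_map (by fun_prop)

/-- The sum of independent gamma variables is a gamma variable, and is independent of the
normalised vector. -/
theorem map_normalize_sum_pi_gammaOrZero {n : ℕ} {a : Fin n → ℝ} (ha : ∀ i, 0 ≤ a i) :
    (Measure.pi fun i => gammaOrZero (a i)).map (fun z => (fun i => z i / ∑ j, z j, ∑ j, z j)) =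
      (dirichletMeasure a).prod (gammaOrZero (∑ i, a i)) := by
  have hsum : 0 ≤ ∑ i, a i := Finset.sum_nonneg fun i _ => ha i
  have := fun i => isProbabilityMeasure_gammaOrZero (ha i)
  have := isProbabilityMeasure_gammaOrZero hsum
  have := isProbabilityMeasure_dirichletMeasure ha
  have hD : Measurable fun (z : Fin n → ℝ) i => z i / ∑ j, z j := by fun_prop
  have hS : Measurable fun z : Fin n → ℝ => ∑ j, z j := by fun_prop
  refine (Measure.prod_eq fun B T hB hT => ?_).symm
  set p := Measure.pi fun i => gammaOrZero (a i) with hp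
  set D := fun (z : Fin n → ℝ) i => z i / ∑ j, z j with hDdef
  -- For fixed `B`, the law of the sum on the event `D ∈ B` is found from its Laplace transform:
  -- tilting by the exponential of the sum amounts to rescaling all coordinates, which leaves `D`
  -- unchanged.
  have hlaw : dirichletMeasure a B • gammaOrZero (∑ i, a i) =
      (p.restrict (D ⁻¹' B)).map fun z => ∑ j, z j := by
    have : IsFiniteMeasure (dirichletMeasure a B • gammaOrZero (∑ i, a i)) :=
      Measure.smul_finite _ (measure_ne_top _ _)
    refine Measure.ext_of_lintegral_exp (fun t ht => ?_) fun t ht => ?_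
    · rw [lintegral_smul_measure, lintegral_exp_gammaOrZero hsum ht]
      exact ENNReal.mul_ne_top (measure_ne_top _ _) ENNReal.ofReal_ne_top
    · have hc : 0 < 1 - t := by linarith
      rw [lintegral_smul_measure, lintegral_exp_gammaOrZero hsum ht,
        lintegral_map (by fun_prop) hS, ← lintegral_indicator (hD hB)]
      have h1 : ∀ z, (D ⁻¹' B).indicator
          (fun z => ENNReal.ofReal (Real.exp (t * ∑ j, z j))) z =
          ENNReal.ofReal (Real.exp (t * ∑ j, z j)) * (D ⁻¹' B).indicator 1 z := by
        intro z
        by_cases hz : z ∈ D ⁻¹' B <;> simp [hz]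
      simp_rw [h1]
      rw [lintegral_exp_sum_mul_pi_gammaOrZero ha ht (measurable_one.indicator (hD hB))]
      have h2 : ∀ z, (D ⁻¹' B).indicator (1 : (Fin n → ℝ) → ℝ≥0∞) (fun i => z i / (1 - t)) =
          (D ⁻¹' B).indicator 1 z := by
        intro z
        have : D (fun i => z i / (1 - t)) = D z := by
          ext i
          simp only [hDdef, ← Finset.sum_div]
          exact div_div_div_cancel_right₀ hc.ne' _ _
        have hmem : (fun i => z i / (1 - t)) ∈ D ⁻¹' B ↔ z ∈ D ⁻¹' B := by
          rw [Set.mem_preimage, this, Set.mem_preimage]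
        by_cases hz : z ∈ D ⁻¹' B
        · rw [Set.indicator_of_mem hz, Set.indicator_of_mem (hmem.2 hz)]
          rfl
        · rw [Set.indicator_of_notMem hz, Set.indicator_of_notMem (mt hmem.1 hz)]
      simp_rw [h2]
      rw [lintegral_indicator_one (hD hB), dirichletMeasure, Measure.map_apply hD hB, smul_eq_mul,
        mul_comm]
  rw [Measure.map_apply (by fun_prop) (hB.prod hT)]
  have := congrArg (fun m => m T) hlaw
  simp only [Measure.smul_apply, smul_eq_mul, Measure.map_apply hS hT,
    Measure.restrict_apply (hS hT)] at this
  rw [this]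
  congr 1
  ext z
  simp [hDdef, and_comm]

/-- Size-biasing one of several independent gamma variables adds to it an independent exponential
variable. -/
theorem lintegral_apply_mul_pi_gammaOrZero {n : ℕ} {a : Fin n → ℝ} (ha : ∀ i, 0 ≤ a i) (i : Fin n)
    {f : (Fin n → ℝ) → ℝ≥0∞} (hf : Measurable f) :
    ∫⁻ z, ENNReal.ofReal (z i) * f z ∂Measure.pi (fun i => gammaOrZero (a i)) =
      ENNReal.ofReal (a i) * ∫⁻ w, ∫⁻ z, f (z + Pi.single i w)
        ∂Measure.pi (fun i => gammaOrZero (a i)) ∂gammaOrZero 1 := by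
  rcases n with _ | n
  · exact i.elim0
  have := fun i => isProbabilityMeasure_gammaOrZero (ha i)
  have := isProbabilityMeasure_gammaOrZero zero_le_one
  have mp := (measurePreserving_piFinSuccAbove (fun i => gammaOrZero (a i)) i).symm
  have hins : Measurable fun p : ℝ × (Fin n → ℝ) => (i.insertNth p.1 p.2 : Fin (n + 1) → ℝ) :=
    (MeasurableEquiv.piFinSuccAbove (fun _ => ℝ) i).symm.measurable
  have hcv : ∀ g : (Fin (n + 1) → ℝ) → ℝ≥0∞, Measurable g →
      ∫⁻ z, g z ∂Measure.pi (fun i => gammaOrZero (a i)) =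
        ∫⁻ r, ∫⁻ x, g (i.insertNth x r) ∂gammaOrZero (a i)
          ∂Measure.pi (fun j => gammaOrZero (a (i.succAbove j))) := by
    intro g hg
    rw [← mp.map_eq, lintegral_map hg (MeasurableEquiv.measurable _)]
    exact lintegral_prod_symm' _ (hg.comp hins)
  have hadd : ∀ (x w : ℝ) (r : Fin n → ℝ), (i.insertNth (x + w) r : Fin (n + 1) → ℝ) =
      (i.insertNth x r : Fin (n + 1) → ℝ) + Pi.single i w := by
    intro x w r
    ext j
    refine i.succAboveCases ?_ (fun j => ?_) j <;> simp
  have hsing : Measurable fun w : ℝ => (Pi.single i w : Fin (n + 1) → ℝ) := by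
    refine measurable_pi_lambda _ fun j => ?_
    by_cases h : j = i
    · subst h; simpa using measurable_id'
    · simp [h]
  rw [hcv _ (by fun_prop)]
  simp only [Fin.insertNth_apply_same]
  -- With the other coordinates `r` frozen, size-biasing raises the shape of coordinate `i` to `a i
  -- + 1`, and such a variable splits as `x + w` with `w` exponential.
  have hstep : ∀ r : Fin n → ℝ,
      ∫⁻ x, ENNReal.ofReal x * f (i.insertNth x r) ∂gammaOrZero (a i) =
      ENNReal.ofReal (a i) * ∫⁻ w, ∫⁻ x, f (i.insertNth x r + Pi.single i w) ∂gammaOrZero (a i)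
        ∂gammaOrZero 1 := by
    intro r
    have hfr : Measurable fun x => f (i.insertNth x r) :=
      hf.comp (hins.comp measurable_prodMk_right)
    rw [lintegral_id_mul_gammaOrZero (ha i) hfr, ← gammaOrZero_add_one (ha i),
      lintegral_map hfr (by fun_prop)]
    simp_rw [← hadd]
    congr 1
    exact lintegral_prod_symm' _ (hfr.comp (measurable_fst.add measurable_snd))
  simp_rw [hstep]
  have hm3 : Measurable fun p : (ℝ × (Fin n → ℝ)) × ℝ =>
      f ((i.insertNth p.2 p.1.2 : Fin (n + 1) → ℝ) + Pi.single i p.1.1) :=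
    hf.comp ((hins.comp (measurable_snd.prodMk (measurable_snd.comp measurable_fst))).add
      (hsing.comp (measurable_fst.comp measurable_fst)))
  have hm2 : Measurable fun p : ℝ × (Fin n → ℝ) =>
      ∫⁻ x, f ((i.insertNth x p.2 : Fin (n + 1) → ℝ) + Pi.single i p.1) ∂gammaOrZero (a i) :=
    hm3.lintegral_prod_right'
  rw [lintegral_const_mul' _ _ ENNReal.ofReal_ne_top]
  congr 1
  refine (lintegral_lintegral_swap (μ := Measure.pi fun j => gammaOrZero (a (i.succAbove j)))
    (ν := gammaOrZero 1) (f := fun (r : Fin n → ℝ) (w : ℝ) => ∫⁻ x,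
      f ((i.insertNth x r : Fin (n + 1) → ℝ) + (Pi.single i w : Fin (n + 1) → ℝ))
        ∂gammaOrZero (a i))
    (hm2.comp measurable_swap).aemeasurable).trans (lintegral_congr fun w => ?_)
  exact (hcv (fun z => f (z + Pi.single i w)) (by fun_prop)).symm

/-! ### Size-biased Dirichlet vectors. -/

/-- The law of `W / (S + W)` for independent gamma variables `S` of shape `k` and `W` of shape
one. -/
noncomputable def stickLaw (k : ℝ) : Measure ℝ :=
  ((gammaOrZero k).prod (gammaOrZero 1)).map fun p => p.2 / (p.1 + p.2)

theorem isProbabilityMeasure_stickLaw {k : ℝ} (hk : 0 ≤ k) :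
    IsProbabilityMeasure (stickLaw k) := by
  have := isProbabilityMeasure_gammaOrZero hk
  have := isProbabilityMeasure_gammaOrZero zero_le_one
  exact Measure.isProbabilityMeasure_map (by fun_prop)

/-- Strict positivity is what produces atoms. The endpoint 1 is kept because the shape-`k` variable
is zero when `k = 0`. -/
theorem ae_mem_Ioc_stickLaw {k : ℝ} (hk : 0 ≤ k) : ∀ᵐ v ∂stickLaw k, v ∈ Set.Ioc (0 : ℝ) 1 := by
  have := isProbabilityMeasure_gammaOrZero hk
  have := isProbabilityMeasure_gammaOrZero zero_le_one
  refine (ae_map_iff (by fun_prop) measurableSet_Ioc).2 ?_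
  filter_upwards [Measure.quasiMeasurePreserving_fst.ae (ae_nonneg_gammaOrZero hk),
    Measure.quasiMeasurePreserving_snd.ae (ae_pos_gammaOrZero one_pos)] with p hs hw
  exact ⟨by positivity, (div_le_one (by positivity)).2 (by linarith)⟩

/-- The sum is gamma of positive shape, even if some coordinates are identically zero. -/
theorem ae_sum_pos_pi_gammaOrZero {n : ℕ} {a : Fin n → ℝ} (ha : ∀ i, 0 ≤ a i)
    (hsum : 0 < ∑ i, a i) :
    ∀ᵐ z ∂Measure.pi (fun i => gammaOrZero (a i)), 0 < ∑ i, z i := by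
  have := isProbabilityMeasure_dirichletMeasure ha
  have := isProbabilityMeasure_gammaOrZero hsum.le
  have h : ∀ᵐ q ∂(dirichletMeasure a).prod (gammaOrZero (∑ i, a i)), 0 < q.2 :=
    Measure.quasiMeasurePreserving_snd.ae (ae_pos_gammaOrZero hsum)
  rw [← map_normalize_sum_pi_gammaOrZero ha] at h
  exact ae_of_ae_map (p := fun q : (Fin n → ℝ) × ℝ => 0 < q.2) (by fun_prop) h

/-- Size-biasing a Dirichlet vector by its `i`-th coordinate mixes it with the `i`-th vertex. -/
theorem lintegral_apply_mul_dirichletMeasure {n : ℕ} {a : Fin n → ℝ} (ha : ∀ i, 0 ≤ a i)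
    (hsum : 0 < ∑ i, a i) (i : Fin n) {f : (Fin n → ℝ) → ℝ≥0∞} (hf : Measurable f) :
    ENNReal.ofReal (∑ i, a i) * ∫⁻ d, ENNReal.ofReal (d i) * f d ∂dirichletMeasure a =
      ENNReal.ofReal (a i) * ∫⁻ v, ∫⁻ d, f (Pi.single i v + (1 - v) • d) ∂dirichletMeasure a
        ∂stickLaw (∑ i, a i) := by
  have := fun i => isProbabilityMeasure_gammaOrZero (ha i)
  have := isProbabilityMeasure_gammaOrZero hsum.le
  have := isProbabilityMeasure_gammaOrZero zero_le_one
  have := isProbabilityMeasure_dirichletMeasure ha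
  have hsing : Measurable fun w : ℝ => (Pi.single i w : Fin n → ℝ) := by
    refine measurable_pi_lambda _ fun j => ?_
    by_cases h : j = i
    · subst h; simpa using measurable_id'
    · simp [h]
  have := isProbabilityMeasure_gammaOrZero (show 0 ≤ ∑ i, a i + 1 by linarith)
  have hmean : ∫⁻ s, ENNReal.ofReal s ∂gammaOrZero (∑ i, a i) = ENNReal.ofReal (∑ i, a i) := by
    simpa using lintegral_id_mul_gammaOrZero hsum.le (f := fun _ => 1) measurable_const
  have hg : Measurable fun d : Fin n → ℝ => ENNReal.ofReal (d i) * f d := by fun_prop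
  have hpos := ae_sum_pos_pi_gammaOrZero ha hsum
  have hN : Measurable fun z : Fin n → ℝ => ((fun i => z i / ∑ j, z j, ∑ j, z j) :
    (Fin n → ℝ) × ℝ) := by fun_prop
  -- The factor `∑ i, a i` is the mean of the sum, which is independent of the Dirichlet vector.
  -- Multiplying by that sum undoes the normalisation and turns `d i` into `z i`, to which gamma
  -- size-biasing applies.
  calc ENNReal.ofReal (∑ i, a i) * ∫⁻ d, ENNReal.ofReal (d i) * f d ∂dirichletMeasure a
      = ∫⁻ q, (ENNReal.ofReal (q.1 i) * f q.1) * ENNReal.ofReal q.2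
          ∂(dirichletMeasure a).prod (gammaOrZero (∑ i, a i)) := by
        rw [lintegral_prod_mul hg.aemeasurable (by fun_prop), hmean, mul_comm]
    _ = ∫⁻ z, ENNReal.ofReal (z i) * f (fun i => z i / ∑ j, z j)
          ∂Measure.pi (fun i => gammaOrZero (a i)) := by
        rw [← map_normalize_sum_pi_gammaOrZero ha, lintegral_map (by fun_prop) hN]
        refine lintegral_congr_ae ?_
        filter_upwards [hpos] with z hz
        rw [mul_right_comm, ← ENNReal.ofReal_mul' hz.le, div_mul_cancel₀ _ hz.ne']
    _ = ENNReal.ofReal (a i) * ∫⁻ w, ∫⁻ z,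
          f (fun j => (z + Pi.single i w : Fin n → ℝ) j / ∑ l, (z + Pi.single i w : Fin n → ℝ) l)
          ∂Measure.pi (fun i => gammaOrZero (a i)) ∂gammaOrZero 1 :=
        lintegral_apply_mul_pi_gammaOrZero ha i (f := fun z => f fun j => z j / ∑ l, z l)
          (by fun_prop)
    _ = ENNReal.ofReal (a i) * ∫⁻ w, ∫⁻ q,
          f (Pi.single i (w / (q.2 + w)) + (1 - w / (q.2 + w)) • q.1)
          ∂(dirichletMeasure a).prod (gammaOrZero (∑ i, a i)) ∂gammaOrZero 1 := by
        congr 1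
        refine lintegral_congr_ae ?_
        filter_upwards [ae_pos_gammaOrZero one_pos] with w hw
        rw [← map_normalize_sum_pi_gammaOrZero ha, lintegral_map (by fun_prop) hN]
        refine lintegral_congr_ae ?_
        filter_upwards [hpos] with z hz
        -- With S = ∑ z, the vector (z + w e_i)/(S + w) is the convex combination of e_i and z/S
        -- with weights w/(S + w) and S/(S + w).
        congr 1
        ext j
        have h1 : ∑ l, (z + Pi.single i w : Fin n → ℝ) l = ∑ l, z l + w := by
          simp [Finset.sum_add_distrib]
        have h2 : (Pi.single i (w / (∑ l, z l + w)) : Fin n → ℝ) j =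
            (Pi.single i w : Fin n → ℝ) j / (∑ l, z l + w) := by
          by_cases h : j = i
          · subst h; simp
          · simp [h]
        have : 0 < ∑ l, z l + w := by linarith
        rw [h1]
        simp only [Pi.add_apply, Pi.smul_apply, smul_eq_mul, h2]
        field_simp
        ring
    _ = ENNReal.ofReal (a i) * ∫⁻ v, ∫⁻ d, f (Pi.single i v + (1 - v) • d) ∂dirichletMeasure a
        ∂stickLaw (∑ i, a i) := by
        congr 1
        have hm : Measurable fun p : ℝ × (Fin n → ℝ) => f (Pi.single i p.1 + (1 - p.1) • p.2) :=
          hf.comp ((hsing.comp measurable_fst).add (by fun_prop))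
        have hm' : Measurable fun v : ℝ =>
            ∫⁻ d, f (Pi.single i v + (1 - v) • d) ∂dirichletMeasure a := hm.lintegral_prod_right'
        rw [stickLaw, lintegral_map hm' (by fun_prop)]
        refine Eq.trans (lintegral_congr fun w => ?_) (lintegral_prod_symm' _
          (hm'.comp (f := fun p : ℝ × ℝ => p.2 / (p.1 + p.2)) (by fun_prop))).symm
        exact lintegral_prod_symm' _ (hm.comp (f := fun q : (Fin n → ℝ) × ℝ =>
          (w / (q.2 + w), q.1)) (by fun_prop))

theorem ae_pos_dirichletMeasure {n : ℕ} {a : Fin n → ℝ} (ha : ∀ i, 0 ≤ a i) {i : Fin n}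
    (hi : 0 < a i) : ∀ᵐ d ∂dirichletMeasure a, 0 < d i := by
  have := fun i => isProbabilityMeasure_gammaOrZero (ha i)
  have hsum : 0 < ∑ i, a i := Finset.sum_pos' (fun i _ => ha i) ⟨i, Finset.mem_univ i, hi⟩
  refine (ae_map_iff (by fun_prop)
    (measurableSet_lt measurable_const (measurable_pi_apply i))).2 ?_
  filter_upwards [ae_sum_pos_pi_gammaOrZero ha hsum,
    (Measure.quasiMeasurePreserving_eval (fun i => gammaOrZero (a i)) i).ae
      (ae_pos_gammaOrZero hi)] with z hz hzi
  exact div_pos hzi hz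

/-! ### Finite-dimensional projections of a random measure. -/

/-- Finitely many measurable sets are unions of fibres of a measurable map to a finite type. -/
theorem exists_measurable_fin_preimage {X : Type*} [MeasurableSpace X] (T : Finset (Set X))
    (hT : ∀ s ∈ T, MeasurableSet s) :
    ∃ (n : ℕ) (h : X → Fin n), Measurable h ∧ ∀ s ∈ T, ∃ b : Set (Fin n), s = h ⁻¹' b := by
  classical
  -- A point is sent to its pattern of memberships in the sets of `T`; there are finitely many
  -- patterns.
  let e := Fintype.equivFin (T → Prop)
  have hm : Measurable fun (x : X) (s : T) => x ∈ s.1 :=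
    measurable_pi_lambda _ fun s => (hT s.1 s.2).mem
  refine ⟨_, fun x => e fun s => x ∈ s.1, (measurable_of_finite e).comp hm, fun s hs => ?_⟩
  refine ⟨{j | e.symm j ⟨s, hs⟩}, ?_⟩
  ext x
  simp

/-- The vector of the masses that `Q` gives to the fibres of `h`. -/
noncomputable def fiberMass {X : Type*} [MeasurableSpace X] {n : ℕ} (h : X → Fin n)
    (Q : ProbabilityMeasure X) (i : Fin n) : ℝ :=
  (Q : Measure X).real (h ⁻¹' {i})

section FiberMass

variable {X : Type*} [MeasurableSpace X] {n : ℕ} {h : X → Fin n}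

theorem ProbabilityMeasure.measurable_apply {s : Set X} (hs : MeasurableSet s) :
    Measurable fun Q : ProbabilityMeasure X => (Q : Measure X) s :=
  (Measure.measurable_coe hs).comp measurable_subtype_coe

theorem measurable_fiberMass (hh : Measurable h) : Measurable (fiberMass h) :=
  measurable_pi_lambda _ fun i =>
    (ProbabilityMeasure.measurable_apply (hh (measurableSet_singleton i))).ennreal_toReal

theorem MeasureTheory.Measure.apply_preimage_eq_sum (Q : Measure X) (hh : Measurable h)
    (b : Set (Fin n)) : Q (h ⁻¹' b) = ∑ i, b.indicator 1 i * Q (h ⁻¹' {i}) := by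
  rw [← Measure.map_apply hh b.toFinite.measurableSet,
    ← lintegral_indicator_one b.toFinite.measurableSet, lintegral_fintype]
  simp_rw [Measure.map_apply hh (measurableSet_singleton _)]

theorem apply_preimage_eq_sum_fiberMass (hh : Measurable h) (Q : ProbabilityMeasure X)
    (b : Set (Fin n)) :
    (Q : Measure X) (h ⁻¹' b) = ∑ i, b.indicator 1 i * ENNReal.ofReal (fiberMass h Q i) := by
  rw [Measure.apply_preimage_eq_sum _ hh]
  exact Finset.sum_congr rfl fun i _ => by rw [fiberMass, ofReal_measureReal]

theorem IsDirichletProcess.map_fiberMass {Ω : Type*} [MeasurableSpace Ω] {μ : Measure Ω}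
    {α : Measure X} {P : Ω → ProbabilityMeasure X} (hP : IsDirichletProcess μ α P)
    (hh : Measurable h) :
    μ.map (fun ω => fiberMass h (P ω)) = dirichletMeasure fun i => α.real (h ⁻¹' {i}) := by
  refine hP.map_partition n (fun i => h ⁻¹' {i}) (fun i => hh (measurableSet_singleton i))
    (fun i j hij => ?_) ?_
  · exact Disjoint.preimage h (by simpa using hij)
  · ext x; simp

/-- A Dirichlet process almost surely charges every set that its parameter charges. -/
theorem IsDirichletProcess.ae_pos {Ω : Type*} [MeasurableSpace Ω] {μ : Measure Ω}
    {α : Measure X} [IsFiniteMeasure α] {P : Ω → ProbabilityMeasure X}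
    (hP : IsDirichletProcess μ α P) {A : Set X} (hA : MeasurableSet A) (hA0 : 0 < α A) :
    ∀ᵐ ω ∂μ, 0 < (P ω : Measure X) A := by
  obtain ⟨n, h, hh, hT⟩ := exists_measurable_fin_preimage {A} (by simpa using hA)
  obtain ⟨b, rfl⟩ := hT A (by simp)
  rw [Measure.apply_preimage_eq_sum _ hh] at hA0
  -- Some single fibre inside the set has positive parameter, and `P` already charges that fibre.
  obtain ⟨i, -, hi⟩ := Finset.exists_ne_zero_of_sum_ne_zero hA0.ne'
  have hib : i ∈ b := by
    by_contra hib
    simp [hib] at hi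
  have hai : 0 < α.real (h ⁻¹' {i}) :=
    ENNReal.toReal_pos (right_ne_zero_of_mul hi) (measure_ne_top _ _)
  have hd := ae_pos_dirichletMeasure (a := fun i => α.real (h ⁻¹' {i}))
    (fun _ => measureReal_nonneg) hai
  rw [← hP.map_fiberMass hh] at hd
  filter_upwards [ae_of_ae_map ((measurable_fiberMass hh).comp hP.measurable).aemeasurable hd]
    with ω hω
  exact (pos_of_ne_zero fun h0 => by simp [fiberMass, Measure.real, h0] at hω).trans_le
    (measure_mono (Set.preimage_mono (Set.singleton_subset_iff.2 hib)))

end FiberMass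

/-! ### Mixtures with a point mass. -/

/-- The mixture of the point mass at `x` with weight `v`, truncated to `[0, 1]`, and of `Q`. -/
noncomputable def ProbabilityMeasure.mixDirac {X : Type*} [MeasurableSpace X] (v : ℝ) (x : X)
    (Q : ProbabilityMeasure X) : ProbabilityMeasure X :=
  ⟨min (ENNReal.ofReal v) 1 • Measure.dirac x + (1 - min (ENNReal.ofReal v) 1) • (Q : Measure X),
    ⟨by simp⟩⟩

section MixDirac

variable {X : Type*} [MeasurableSpace X]

theorem ProbabilityMeasure.mixDirac_apply {v : ℝ} (hv : v ∈ Set.Ioc (0 : ℝ) 1) (x : X)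
    (Q : ProbabilityMeasure X) {s : Set X} (hs : MeasurableSet s) :
    (ProbabilityMeasure.mixDirac v x Q : Measure X) s =
      ENNReal.ofReal v * s.indicator 1 x + ENNReal.ofReal (1 - v) * (Q : Measure X) s := by
  have h1 : min (ENNReal.ofReal v) 1 = ENNReal.ofReal v :=
    min_eq_left (by simpa using hv.2)
  simp only [mixDirac, ProbabilityMeasure.coe_mk, h1, Measure.add_apply, Measure.smul_apply,
    smul_eq_mul, Measure.dirac_apply' x hs, ENNReal.ofReal_sub _ hv.1.le, ENNReal.ofReal_one]

theorem ProbabilityMeasure.measurable_mixDirac :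
    Measurable fun p : X × ℝ × ProbabilityMeasure X =>
      ProbabilityMeasure.mixDirac p.2.1 p.1 p.2.2 := by
  refine Measurable.subtype_mk (Measure.measurable_of_measurable_coe _ fun s hs => ?_)
  simp only [Measure.add_apply, Measure.smul_apply, smul_eq_mul, Measure.dirac_apply' _ hs]
  have h1 : Measurable fun p : X × ℝ × ProbabilityMeasure X =>
      s.indicator (1 : X → ℝ≥0∞) p.1 := (measurable_one.indicator hs).comp measurable_fst
  have h2 : Measurable fun p : X × ℝ × ProbabilityMeasure X => (p.2.2 : Measure X) s :=
    (ProbabilityMeasure.measurable_apply hs).comp (measurable_snd.comp measurable_snd)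
  fun_prop

/-- This is the form of the vectors on the right of `lintegral_apply_mul_dirichletMeasure`. -/
theorem fiberMass_mixDirac {n : ℕ} {h : X → Fin n} (hh : Measurable h) {v : ℝ}
    (hv : v ∈ Set.Ioc (0 : ℝ) 1) (x : X) (Q : ProbabilityMeasure X) :
    fiberMass h (ProbabilityMeasure.mixDirac v x Q) =
      Pi.single (h x) v + (1 - v) • fiberMass h Q := by
  ext i
  have h1 : 0 ≤ 1 - v := by linarith [hv.2]
  simp only [fiberMass, Measure.real,
    ProbabilityMeasure.mixDirac_apply hv x Q (hh (measurableSet_singleton i))]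
  rw [ENNReal.toReal_add (by by_cases hx : h x = i <;> simp [hx])
    (ENNReal.mul_ne_top ENNReal.ofReal_ne_top (measure_ne_top _ _)), ENNReal.toReal_mul,
    ENNReal.toReal_mul, ENNReal.toReal_ofReal hv.1.le, ENNReal.toReal_ofReal h1]
  by_cases hx : h x = i
  · subst hx
    simp [fiberMass, Measure.real]
  · simp [fiberMass, Measure.real, hx]

end MixDirac

/-! ### The posterior identity in finite dimensions. -/

section Posterior

variable {Ω X : Type*} [MeasurableSpace Ω] [MeasurableSpace X] {μ : Measure Ω}
  [IsProbabilityMeasure μ] {k : ℝ≥0} {P₀ : Measure X} [IsProbabilityMeasure P₀]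
  {P : Ω → ProbabilityMeasure X}

/-- A point drawn from a Dirichlet process has law `P₀`, and given that point the process is a
mixture of the point mass there and of an independent copy: the finite-dimensional version. -/
theorem IsDirichletProcess.lintegral_fiberMass (hP : IsDirichletProcess μ (k • P₀) P)
    (hk : 0 < k) {n : ℕ} {h : X → Fin n} (hh : Measurable h) {f : (Fin n → ℝ) → ℝ≥0∞}
    (hf : Measurable f) (b : Set (Fin n)) :
    ∫⁻ ω, f (fiberMass h (P ω)) * (P ω : Measure X) (h ⁻¹' b) ∂μ =
      ∫⁻ x in h ⁻¹' b, ∫⁻ v, ∫⁻ ω, f (fiberMass h (ProbabilityMeasure.mixDirac v x (P ω))) ∂μ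
        ∂stickLaw k ∂P₀ := by
  set a : Fin n → ℝ := fun i => (k • P₀).real (h ⁻¹' {i}) with hadef
  have ha : ∀ i, 0 ≤ a i := fun i => measureReal_nonneg
  have hai : ∀ i, ENNReal.ofReal (a i) = k * P₀ (h ⁻¹' {i}) := by
    intro i
    rw [hadef, ofReal_measureReal]
    rfl
  have hasum : ∑ i, a i = k := by
    have h1 := Measure.apply_preimage_eq_sum P₀ hh Set.univ
    have h2 : ENNReal.ofReal (∑ i, a i) = k := by
      rw [ENNReal.ofReal_sum_of_nonneg fun i _ => ha i]
      simp only [Set.preimage_univ, measure_univ, Set.indicator_univ, Pi.one_apply, one_mul] at h1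
      simp_rw [hai]
      rw [← Finset.mul_sum, ← h1, mul_one]
    rw [← ENNReal.ofReal_coe_nnreal] at h2
    exact (ENNReal.ofReal_eq_ofReal_iff (Finset.sum_nonneg fun i _ => ha i) k.coe_nonneg).1 h2
  have hlaw := hP.map_fiberMass hh
  have hvec : Measurable fun ω => fiberMass h (P ω) := (measurable_fiberMass hh).comp hP.measurable
  have hk0 : (k : ℝ≥0∞) ≠ 0 := by simpa using hk.ne'
  -- The inner integral sees the drawn point `x` only through its fibre `h x`, so integration over
  -- P₀ becomes a finite sum.
  set R : Fin n → ℝ≥0∞ := fun i =>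
    ∫⁻ v, ∫⁻ d, f (Pi.single i v + (1 - v) • d) ∂dirichletMeasure a ∂stickLaw k with hR
  have hRHS : ∀ x, ∫⁻ v, ∫⁻ ω, f (fiberMass h (ProbabilityMeasure.mixDirac v x (P ω))) ∂μ
      ∂stickLaw k = R (h x) := by
    intro x
    refine lintegral_congr_ae ?_
    filter_upwards [ae_mem_Ioc_stickLaw k.coe_nonneg] with v hv
    simp_rw [fiberMass_mixDirac hh hv]
    rw [← hlaw, lintegral_map (by fun_prop) hvec]
  -- The vector identity carries the factor `k` on both sides; it is cancelled at the end, being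
  -- nonzero and finite.
  have hLHS : ∀ i, k * ∫⁻ ω, f (fiberMass h (P ω)) * ENNReal.ofReal (fiberMass h (P ω) i) ∂μ =
      k * (R i * P₀ (h ⁻¹' {i})) := by
    intro i
    have := lintegral_apply_mul_dirichletMeasure ha (hasum ▸ hk) i hf
    rw [hasum, hai, ENNReal.ofReal_coe_nnreal, ← hlaw, lintegral_map (by fun_prop) hvec, hlaw]
      at this
    simp_rw [mul_comm (f _)]
    rw [this, mul_assoc, mul_comm (P₀ _)]
  simp_rw [hRHS, apply_preimage_eq_sum_fiberMass hh, Finset.mul_sum]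
  rw [lintegral_finsetSum _ fun i _ => by fun_prop]
  have hb : MeasurableSet b := b.toFinite.measurableSet
  rw [← lintegral_indicator (hh hb)]
  have hind : ∀ x, (h ⁻¹' b).indicator (fun x => R (h x)) x = (b.indicator R) (h x) := fun x => rfl
  simp_rw [hind]
  rw [← lintegral_map (measurable_of_finite (b.indicator R)) hh, lintegral_fintype]
  refine Finset.sum_congr rfl fun i _ => ?_
  rw [Measure.map_apply hh (measurableSet_singleton i)]
  by_cases hi : i ∈ b
  · simp only [Set.indicator_of_mem hi, Pi.one_apply, one_mul]
    exact (ENNReal.mul_right_inj hk0 ENNReal.coe_ne_top).1 (hLHS i)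
  · simp [hi]

end Posterior

/-! ### Cylinders determine laws on the space of probability measures. -/

section PiSystem

variable {X : Type*} [MeasurableSpace X]

/-- The π-system of the finite-dimensional cylinders of probability measures. -/
def evalCylinders (X : Type*) [MeasurableSpace X] : Set (Set (ProbabilityMeasure X)) :=
  piiUnionInter (fun s : Set X =>
    {G | MeasurableSet[(borel ℝ≥0∞).comap fun Q : ProbabilityMeasure X => (Q : Measure X) s] G})
    {s | MeasurableSet s}

theorem isPiSystem_evalCylinders : IsPiSystem (evalCylinders X) :=
  isPiSystem_piiUnionInter _ (fun s => @MeasurableSpace.isPiSystem_measurableSet _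
    ((borel ℝ≥0∞).comap fun Q : ProbabilityMeasure X => (Q : Measure X) s)) _

theorem univ_mem_evalCylinders : Set.univ ∈ evalCylinders X :=
  ⟨∅, by simp, fun _ => Set.univ, by simp, by simp⟩

theorem generateFrom_evalCylinders :
    MeasurableSpace.generateFrom (evalCylinders X) =
      ProbabilityMeasure.instMeasurableSpace := by
  refine (generateFrom_piiUnionInter_measurableSet (fun s : Set X =>
    (borel ℝ≥0∞).comap fun Q : ProbabilityMeasure X => (Q : Measure X) s) _).trans ?_
  change _ = MeasurableSpace.comap Subtype.val Measure.instMeasurableSpace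
  simp_rw [Measure.instMeasurableSpace, MeasurableSpace.comap_iSup, MeasurableSpace.comap_comp]
  rfl

/-- Finite measures on the product of the space of probability measures with another space agree
if they agree on products of cylinders and measurable sets. -/
theorem ext_of_evalCylinders {Y : Type*} [MeasurableSpace Y]
    {ν₁ ν₂ : Measure (ProbabilityMeasure X × Y)} [IsFiniteMeasure ν₁]
    (H : ∀ G ∈ evalCylinders X, ∀ C, MeasurableSet C → ν₁ (G ×ˢ C) = ν₂ (G ×ˢ C)) : ν₁ = ν₂ := by
  refine ext_of_generate_finite (Set.image2 (· ×ˢ ·) (evalCylinders X) {C | MeasurableSet C})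
    (generateFrom_eq_prod generateFrom_evalCylinders MeasurableSpace.generateFrom_measurableSet
      ⟨fun _ => Set.univ, fun _ => univ_mem_evalCylinders, Set.iUnion_const _⟩
      isCountablySpanning_measurableSet).symm
    (isPiSystem_evalCylinders.prod MeasurableSpace.isPiSystem_measurableSet) ?_ ?_
  · rintro _ ⟨G, hG, C, hC, rfl⟩
    exact H G hG C hC
  · rw [← Set.univ_prod_univ]
    exact H _ univ_mem_evalCylinders _ MeasurableSet.univ

end PiSystem

/-! ### The posterior identity for the process, and its atoms. -/

/-- The kernel that draws a point from a probability measure. -/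
noncomputable def drawKernel (X : Type*) [MeasurableSpace X] : Kernel (ProbabilityMeasure X) X :=
  ⟨fun Q => (Q : Measure X), measurable_subtype_coe⟩

instance (X : Type*) [MeasurableSpace X] : IsMarkovKernel (drawKernel X) :=
  ⟨fun Q => inferInstanceAs (IsProbabilityMeasure (Q : Measure X))⟩

section Posterior

variable {Ω X : Type*} [MeasurableSpace Ω] [MeasurableSpace X] {μ : Measure Ω}
  [IsProbabilityMeasure μ] {k : ℝ≥0} {P₀ : Measure X} [IsProbabilityMeasure P₀]
  {P : Ω → ProbabilityMeasure X}

/-- A point drawn from a Dirichlet process has law `P₀`, and given that point the process is a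
mixture of the point mass there and of an independent copy. -/
theorem IsDirichletProcess.compProd_drawKernel (hP : IsDirichletProcess μ (k • P₀) P)
    (hk : 0 < k) :
    (μ.map P) ⊗ₘ drawKernel X = (P₀.prod ((stickLaw k).prod (μ.map P))).map
      fun p => (ProbabilityMeasure.mixDirac p.2.1 p.1 p.2.2, p.1) := by
  have := isProbabilityMeasure_stickLaw k.coe_nonneg
  have : IsProbabilityMeasure (μ.map P) :=
    Measure.isProbabilityMeasure_map hP.measurable.aemeasurable
  refine ext_of_evalCylinders fun G hG C hC => ?_
  have hGm : MeasurableSet G := by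
    have := MeasurableSpace.measurableSet_generateFrom hG
    rwa [generateFrom_evalCylinders] at this
  obtain ⟨T, hT, g, hg, rfl⟩ := hG
  set G := ⋂ s ∈ T, g s with hGdef
  classical
  -- Including `C` gives one map `h` whose fibres resolve both the cylinder and the set of drawn
  -- points.
  obtain ⟨n, h, hh, hfib⟩ := exists_measurable_fin_preimage (insert C T) (by
    intro s hs
    rcases Finset.mem_insert.1 hs with rfl | hs
    · exact hC
    · exact hT hs)
  obtain ⟨b, rfl⟩ := hfib C (Finset.mem_insert_self _ _)
  -- Each `Q s` with `s ∈ T` is a sum of fibre masses, so the cylinder is a condition on the vector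
  -- `fiberMass h Q`.
  obtain ⟨D, hD, hGD⟩ : ∃ D : Set (Fin n → ℝ), MeasurableSet D ∧ G = fiberMass h ⁻¹' D := by
    have hs : ∀ s ∈ T, ∃ D : Set (Fin n → ℝ), MeasurableSet D ∧ g s = fiberMass h ⁻¹' D := by
      intro s hs
      obtain ⟨c, hc⟩ := hfib s (Finset.mem_insert_of_mem hs)
      obtain ⟨B, hB, hBg⟩ := hg s hs
      refine ⟨(fun d => ∑ i, c.indicator 1 i * ENNReal.ofReal (d i)) ⁻¹' B, ?_, ?_⟩
      · have hB' : MeasurableSet B := by rwa [← BorelSpace.measurable_eq] at hB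
        exact (show Measurable fun d : Fin n → ℝ =>
          ∑ i, c.indicator (1 : Fin n → ℝ≥0∞) i * ENNReal.ofReal (d i) by fun_prop) hB'
      · rw [← hBg]
        ext Q
        simp only [Set.mem_preimage]
        rw [hc, apply_preimage_eq_sum_fiberMass hh]
    choose! D hDm hD using hs
    refine ⟨⋂ s ∈ T, D s, Finset.measurableSet_biInter _ hDm, ?_⟩
    rw [hGdef, Set.preimage_iInter₂]
    exact Set.iInter₂_congr hD
  have hmix := ProbabilityMeasure.measurable_mixDirac (X := X)
  have hf : Measurable (D.indicator (1 : (Fin n → ℝ) → ℝ≥0∞)) := measurable_one.indicator hD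
  have hfm : Measurable fun Q : ProbabilityMeasure X => D.indicator (1 : (Fin n → ℝ) → ℝ≥0∞)
      (fiberMass h Q) := hf.comp (measurable_fiberMass hh)
  have key := hP.lintegral_fiberMass hk hh hf b
  have hdraw : Measurable fun Q => drawKernel X Q (h ⁻¹' b) :=
    ProbabilityMeasure.measurable_apply hC
  rw [Measure.compProd_apply_prod hGm hC, ← lintegral_indicator hGm,
    Measure.map_apply (hmix.prodMk measurable_fst) (hGm.prod hC),
    lintegral_map (hdraw.indicator hGm) hP.measurable,
    ← lintegral_indicator_one ((hmix.prodMk measurable_fst) (hGm.prod hC))]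
  have hfin : ∀ p : X × ℝ × ProbabilityMeasure X,
      ((fun p : X × ℝ × ProbabilityMeasure X =>
        (ProbabilityMeasure.mixDirac p.2.1 p.1 p.2.2, p.1)) ⁻¹' G ×ˢ (h ⁻¹' b)).indicator 1 p =
      (h ⁻¹' b).indicator (1 : X → ℝ≥0∞) p.1 *
        D.indicator 1 (fiberMass h (ProbabilityMeasure.mixDirac p.2.1 p.1 p.2.2)) := by
    intro p
    rw [hGD]
    by_cases h1 : h p.1 ∈ b <;>
      by_cases h2 : fiberMass h (ProbabilityMeasure.mixDirac p.2.1 p.1 p.2.2) ∈ D <;>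
      simp [Set.indicator, h1, h2]
  have hm1 : Measurable fun p : X × ℝ × ProbabilityMeasure X => D.indicator
      (1 : (Fin n → ℝ) → ℝ≥0∞) (fiberMass h (ProbabilityMeasure.mixDirac p.2.1 p.1 p.2.2)) :=
    hfm.comp hmix
  have hm2 : Measurable fun p : X × ℝ × ProbabilityMeasure X =>
      (h ⁻¹' b).indicator (1 : X → ℝ≥0∞) p.1 := (measurable_one.indicator hC).comp measurable_fst
  simp_rw [hfin]
  refine Eq.trans (lintegral_congr fun ω => ?_)
    (key.trans (Eq.trans ?_ (lintegral_prod _ (hm2.mul hm1).aemeasurable).symm))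
  · by_cases hω : fiberMass h (P ω) ∈ D
    · have : P ω ∈ G := by rw [hGD]; exact hω
      rw [Set.indicator_of_mem this, Set.indicator_of_mem hω, Pi.one_apply, one_mul]
      rfl
    · have : P ω ∉ G := by rw [hGD]; exact hω
      simp [this, hω]
  · rw [← lintegral_indicator hC]
    refine lintegral_congr fun x => ?_
    have hpair : Measurable fun p : ℝ × ProbabilityMeasure X => (x, p) := measurable_prodMk_left
    have hx0 := hmix.comp hpair
    have hx1 : Measurable fun p : ℝ × ProbabilityMeasure X => D.indicator
        (1 : (Fin n → ℝ) → ℝ≥0∞) (fiberMass h (ProbabilityMeasure.mixDirac p.1 x p.2)) :=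
      hfm.comp hx0
    have hprod : ∫⁻ v, ∫⁻ ω, D.indicator (1 : (Fin n → ℝ) → ℝ≥0∞)
        (fiberMass h (ProbabilityMeasure.mixDirac v x (P ω))) ∂μ ∂stickLaw k =
        ∫⁻ p, D.indicator (1 : (Fin n → ℝ) → ℝ≥0∞)
          (fiberMass h (ProbabilityMeasure.mixDirac p.1 x p.2)) ∂(stickLaw k).prod (μ.map P) := by
      refine Eq.trans (lintegral_congr fun v => ?_) (lintegral_prod _ hx1.aemeasurable).symm
      exact (lintegral_map (hx1.comp measurable_prodMk_left) hP.measurable).symm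
    have hconst := lintegral_const_mul (μ := (stickLaw k).prod (μ.map P))
      ((h ⁻¹' b).indicator (1 : X → ℝ≥0∞) x) hx1
    refine Eq.trans ?_ hconst.symm
    rw [← hprod]
    by_cases hx : x ∈ h ⁻¹' b
    · have hx' : (h ⁻¹' b).indicator (1 : X → ℝ≥0∞) x = 1 := Set.indicator_of_mem hx _
      rw [hx', one_mul]
      exact Set.indicator_of_mem hx _
    · have hx' : (h ⁻¹' b).indicator (1 : X → ℝ≥0∞) x = 0 := Set.indicator_of_notMem hx _
      rw [hx', zero_mul]
      exact Set.indicator_of_notMem hx _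

/-- Almost surely, a Dirichlet process charges almost every point drawn from it. -/
theorem IsDirichletProcess.ae_ae_singleton_pos [MeasurableSingletonClass X]
    (hX : Measurable (fun q : ProbabilityMeasure X × X => (q.1 : Measure X) {q.2}))
    (hP : IsDirichletProcess μ (k • P₀) P) (hk : 0 < k) :
    ∀ᵐ ω ∂μ, ∀ᵐ x ∂(P ω : Measure X), 0 < (P ω : Measure X) {x} := by
  have := isProbabilityMeasure_stickLaw k.coe_nonneg
  have : IsProbabilityMeasure (μ.map P) :=
    Measure.isProbabilityMeasure_map hP.measurable.aemeasurable
  -- Measurability of (Q, x) ↦ Q({x}) lets the almost sure property be carried between the two sides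
  -- of the identity.
  have hN : MeasurableSet {q : ProbabilityMeasure X × X | 0 < (q.1 : Measure X) {q.2}} :=
    measurableSet_lt measurable_const hX
  have hae : ∀ᵐ q ∂(μ.map P) ⊗ₘ drawKernel X, 0 < (q.1 : Measure X) {q.2} := by
    rw [hP.compProd_drawKernel hk]
    refine (ae_map_iff (ProbabilityMeasure.measurable_mixDirac.prodMk
      measurable_fst).aemeasurable hN).2 ?_
    have hv : ∀ᵐ p ∂P₀.prod ((stickLaw k).prod (μ.map P)), p.2.1 ∈ Set.Ioc (0 : ℝ) 1 :=
      Measure.quasiMeasurePreserving_snd.ae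
        (Measure.quasiMeasurePreserving_fst.ae (ae_mem_Ioc_stickLaw k.coe_nonneg))
    filter_upwards [hv] with p hp
    rw [ProbabilityMeasure.mixDirac_apply hp _ _ (measurableSet_singleton _)]
    simp [hp.1]
  exact ae_of_ae_map hP.measurable.aemeasurable (Measure.ae_ae_of_ae_compProd hae)

/-- Almost surely, a Dirichlet process has an atom in a given set that `P₀` charges. -/
theorem IsDirichletProcess.ae_exists_atom [MeasurableSingletonClass X]
    (hX : Measurable (fun q : ProbabilityMeasure X × X => (q.1 : Measure X) {q.2}))
    (hP : IsDirichletProcess μ (k • P₀) P) (hk : 0 < k) {A : Set X} (hA : MeasurableSet A)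
    (hA0 : 0 < P₀ A) : ∀ᵐ ω ∂μ, ∃ x ∈ A, 0 < (P ω : Measure X) {x} := by
  have hA0' : 0 < (k • P₀) A := by
    rw [Measure.smul_apply, ENNReal.smul_def, smul_eq_mul]
    exact ENNReal.mul_pos (by simpa using hk.ne') hA0.ne'
  filter_upwards [hP.ae_pos hA hA0', hP.ae_ae_singleton_pos hX hk] with ω h1 h2
  -- Otherwise all of `A` lies in the `P ω`-null set of points that are not atoms.
  by_contra! hcon
  refine h1.ne' (measure_mono_null (fun x hx => ?_) h2)
  simpa using hcon x hx

end Posterior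

/-! ### The real line: atoms as jumps, and all intervals simultaneously. -/

/-- The singleton {x} is a section of the diagonal, which is measurable, and kernels measure
sections measurably. -/
theorem measurable_apply_singleton_real :
    Measurable fun q : ProbabilityMeasure ℝ × ℝ => (q.1 : Measure ℝ) {q.2} := by
  let κ : Kernel (ProbabilityMeasure ℝ × ℝ) ℝ := (drawKernel ℝ).comap Prod.fst measurable_fst
  have ht : MeasurableSet {p : (ProbabilityMeasure ℝ × ℝ) × ℝ | p.2 = p.1.2} :=
    measurableSet_eq_fun measurable_snd (measurable_snd.comp measurable_fst)
  exact Kernel.measurable_kernel_prodMk_left (κ := κ) ht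

theorem mem_jumpSet_cdf_iff (Q : Measure ℝ) [IsProbabilityMeasure Q] (x : ℝ) :
    x ∈ jumpSet (cdf Q) ↔ 0 < Q {x} := by
  conv_rhs => rw [← measure_cdf Q]
  rw [StieltjesFunction.measure_singleton, ENNReal.ofReal_pos, sub_pos]
  rfl

/-- A point with points of `I` on both sides is interior, so only a least and a greatest element can
remain. -/
theorem Set.OrdConnected.finite_diff_interior {I : Set ℝ} (hI : I.OrdConnected) :
    (I \ interior I).Finite := by
  have h1 : {x | IsLeast I x}.Subsingleton := fun x hx y hy => hx.unique hy
  have h2 : {x | IsGreatest I x}.Subsingleton := fun x hx y hy => hx.unique hy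
  refine (h1.finite.union h2.finite).subset fun x hx => ?_
  by_contra hcon
  simp only [Set.mem_union, Set.mem_ofPred_eq, IsLeast, IsGreatest, hx.1, true_and, not_or,
    lowerBounds, upperBounds, not_forall, not_le] at hcon
  obtain ⟨⟨y, hy, hyx⟩, z, hz, hxz⟩ := hcon
  exact hx.2 (mem_interior.2 ⟨Set.Ioo y z, Set.Ioo_subset_Icc_self.trans (hI.out hy hz),
    isOpen_Ioo, hyx, hxz⟩)

/-- An open set of reals of positive measure contains a rational interval of positive measure. -/
theorem IsOpen.exists_rat_Ioo_measure_pos {U : Set ℝ} (hU : IsOpen U) {Q : Measure ℝ}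
    (hQ : 0 < Q U) : ∃ p q : ℚ, Set.Ioo (p : ℝ) q ⊆ U ∧ 0 < Q (Set.Ioo (p : ℝ) q) := by
  by_contra! hcon
  refine hQ.ne' (measure_mono_null (t := ⋃ (p : ℚ) (q : ℚ) (_ : Set.Ioo (p : ℝ) q ⊆ U),
    Set.Ioo (p : ℝ) q) (fun x hx => ?_) ?_)
  · obtain ⟨a, b, hx', hab⟩ := mem_nhds_iff_exists_Ioo_subset.1 (hU.mem_nhds hx)
    obtain ⟨p, hap, hpx⟩ := exists_rat_btwn hx'.1
    obtain ⟨q, hxq, hqb⟩ := exists_rat_btwn hx'.2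
    simp only [Set.mem_iUnion]
    exact ⟨p, q, (Set.Ioo_subset_Ioo hap.le hqb.le).trans hab, hpx, hxq⟩
  · refine measure_iUnion_null fun p => measure_iUnion_null fun q => measure_iUnion_null fun h => ?_
    simpa using hcon p q h

theorem mainTheorem3 {Ω : Type*} [MeasurableSpace Ω] (μ : Measure Ω) [IsProbabilityMeasure μ]
    (k : ℝ≥0) (hk : 0 < k) :
    (∀ (X : Type*) [MeasurableSpace X] [MeasurableSingletonClass X],
      Measurable (fun q : ProbabilityMeasure X × X => (q.1 : Measure X) {q.2}) →
      ∀ (P₀ : Measure X) [IsProbabilityMeasure P₀] (P : Ω → ProbabilityMeasure X),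
        IsDirichletProcess μ (k • P₀) P →
        ∀ A : Set X, MeasurableSet A → 0 < P₀ A →
          ∀ᵐ ω ∂μ, ∃ x ∈ A, 0 < (P ω : Measure X) {x}) ∧
    (∀ (P₀ : Measure ℝ) [IsProbabilityMeasure P₀] (P : Ω → ProbabilityMeasure ℝ),
      IsDirichletProcess μ (k • P₀) P →
      ∀ᵐ ω ∂μ, ∀ I : Set ℝ, I.OrdConnected →
        (∀ S : Set ℝ, S.Finite → 0 < P₀ (I \ S)) →
        (I ∩ jumpSet (cdf (P ω : Measure ℝ))).Infinite) := by
  refine ⟨fun X _ _ hX P₀ _ P hP A hA hA0 => hP.ae_exists_atom hX hk hA hA0, fun P₀ _ P hP => ?_⟩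
  -- Countably many intervals share one null set, chosen before `I`.
  have hrat : ∀ᵐ ω ∂μ, ∀ p q : ℚ, 0 < P₀ (Set.Ioo (p : ℝ) q) →
      ∃ x ∈ Set.Ioo (p : ℝ) q, 0 < (P ω : Measure ℝ) {x} := by
    simp_rw [ae_all_iff]
    exact fun p q h => hP.ae_exists_atom measurable_apply_singleton_real hk measurableSet_Ioo h
  filter_upwards [hrat] with ω hω I hI hI0
  intro hfin
  have hopen : IsOpen (interior I \ (I ∩ jumpSet (cdf (P ω : Measure ℝ)))) :=
    isOpen_interior.sdiff hfin.isClosed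
  -- The finite set removed consists of the endpoints of `I` and its supposedly finite set of jumps.
  have hpos := hI0 _ (hI.finite_diff_interior.union hfin)
  obtain ⟨p, q, hsub, hpq⟩ := hopen.exists_rat_Ioo_measure_pos
    (hpos.trans_le (measure_mono fun x hx => ⟨by
      by_contra h
      exact hx.2 (Or.inl ⟨hx.1, h⟩), fun h => hx.2 (Or.inr h)⟩))
  obtain ⟨x, hx, hx0⟩ := hω p q hpq
  exact (hsub hx).2 ⟨interior_subset (hsub hx).1, (mem_jumpSet_cdf_iff _ x).2 hx0⟩
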